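/- Let $A$ be a (not necessarily unital) $C^*$-algebra and $E$ a Hilbert $C^*$-module over $A$. Let $L(E)$ be the algebra of bounded adjointable operators on $E$ and $K(E)\subseteq L(E)$ the norm-closed linear span of the operators $z\mapsto x\langle y,z\rangle$, $x,y\in E$. A closed densely defined $A$-linear operator $t:D(t)\subseteq E\to E$ with densely defined adjoint $t^*$ is called regular if $1+t^*t$ has dense range; $R(E)$ denotes the set of regular operators on $E$, and $L(E)\subseteq R(E)$ (the operators with $D(t)=E$). The graph $G(t)=\{(x,tx):x\in D(t)\}$ of a regular operator is orthogonally complemented in the Hilbert $C^*$-module $E\oplus E$; let $P_{G(t)}$ be the orthogonal projection onto it. The gap metric on $R(E)$ is $g(t,s)=\|P_{G(t)}-P_{G(s)}\|$. A regular operator $t$ is called Fredholm if there are $G,G'\in L(E)$ such that $Gt$ and $tG'$ are closable and their closures belong to $L(E)$ and are equal to $1$ modulo $K(E)$. Then the set of all bounded adjointable Fredholm operators on $E$ is open in $R(E)$ with respect to the gap metric. -/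

import Mathlib

open scoped InnerProductSpace WithCStarModule

set_option linter.unusedSectionVars false

noncomputable section

namespace HilbertCStar

variable (A : Type*) {E : Type*} [NonUnitalCStarAlgebra A] [PartialOrder A] [StarOrderedRing A]
  [NormedAddCommGroup E] [NormedSpace ℂ E] [SMul A E] [CStarModule A E]

/-! ### Bounded adjointable operators and compact operators -/

/-- `T` belongs to `L(E)`: it has an adjoint `S` for the `A`-valued inner product. -/
def IsAdjointable (T : E →L[ℂ] E) : Prop :=
  ∃ S : E →L[ℂ] E, ∀ x y : E, ⟪T x, y⟫_A = ⟪x, S y⟫_A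

variable {A} in
lemma eq_of_inner_eq {x y : E} (h : ∀ z : E, ⟪z, x⟫_A = ⟪z, y⟫_A) : x = y := by
  have h1 : ⟪x - y, x - y⟫_A = 0 := by rw [CStarModule.inner_sub_right, h, sub_self]
  exact sub_eq_zero.mp (CStarModule.inner_self.mp h1)

variable {A} in
lemma norm_smul_le' (a : A) (x : E) : ‖a • x‖ ≤ ‖a‖ * ‖x‖ := by
  have h : ‖a • x‖ ^ 2 ≤ (‖a‖ * ‖x‖) ^ 2 := by
    rw [CStarModule.norm_sq_eq A]
    calc ‖⟪a • x, a • x⟫_A‖ = ‖a * (⟪x, x⟫_A * star a)‖ := by simp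
      _ ≤ ‖a‖ * (‖⟪x, x⟫_A‖ * ‖star a‖) :=
          (norm_mul_le _ _).trans (mul_le_mul_of_nonneg_left (norm_mul_le _ _) (norm_nonneg _))
      _ = (‖a‖ * ‖x‖) ^ 2 := by rw [norm_star, ← CStarModule.norm_sq_eq A]; ring
  exact (pow_le_pow_iff_left₀ (norm_nonneg _) (by positivity) (by simp)).mp h

/-- The elementary operator `z ↦ x ⟨y, z⟩`. -/
def elementary (x y : E) : E →L[ℂ] E :=
  LinearMap.mkContinuous
    { toFun := fun z => ⟪y, z⟫_A • x
      map_add' := fun z w => eq_of_inner_eq (A := A) fun v => by simp [add_mul]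
      map_smul' := fun c z => eq_of_inner_eq (A := A) fun v => by simp [smul_mul_assoc] }
    (‖y‖ * ‖x‖)
    (fun z => by
      calc ‖⟪y, z⟫_A • x‖ ≤ ‖⟪y, z⟫_A‖ * ‖x‖ := norm_smul_le' _ _
        _ ≤ (‖y‖ * ‖z‖) * ‖x‖ :=
          mul_le_mul_of_nonneg_right (CStarModule.norm_inner_le E) (norm_nonneg _)
        _ = ‖y‖ * ‖x‖ * ‖z‖ := by ring)

variable (E) in
/-- `K(E)`: the norm-closed linear span of the elementary operators. -/
def compactOperators : Submodule ℂ (E →L[ℂ] E) :=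
  (Submodule.span ℂ {T | ∃ x y : E, T = elementary A x y}).topologicalClosure

/-! ### Regular operators -/

/-- The graph of the adjoint of `t`: the pairs `(y, z)` with `⟨t x, y⟩ = ⟨x, z⟩` on `D(t)`. -/
def adjointGraph (t : E →ₗ.[ℂ] E) : Submodule ℂ (E × E) where
  carrier := {p | ∀ x : t.domain, ⟪t x, p.1⟫_A = ⟪(x : E), p.2⟫_A}
  add_mem' := fun {p q} hp hq x => by simp [hp x, hq x]
  zero_mem' := fun x => by simp
  smul_mem' := fun c p hp x => by simp [hp x]

/-- The adjoint `t*` of `t` (meaningful when `D(t)` is dense). -/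
def adjoint (t : E →ₗ.[ℂ] E) : E →ₗ.[ℂ] E := (adjointGraph A t).toLinearPMap

/-- `t` is regular: a closed densely defined `A`-linear operator, with densely defined adjoint,
such that `1 + t* t` has dense range. -/
structure IsRegular (t : E →ₗ.[ℂ] E) : Prop where
  smul_mem : ∀ (a : A) (x : t.domain), a • (x : E) ∈ t.domain
  map_smul : ∀ (a : A) (x : t.domain), t ⟨a • (x : E), smul_mem a x⟩ = a • t x
  isClosed : t.IsClosed
  dense_domain : Dense (t.domain : Set E)
  dense_adjoint_domain : Dense ((adjoint A t).domain : Set E)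
  dense_range : Dense {z : E | ∃ (x : t.domain) (h : t x ∈ (adjoint A t).domain),
    z = x + adjoint A t ⟨t x, h⟩}

variable (E) in
/-- `R(E)`: the regular operators on `E`. -/
structure RegularOp where
  op : E →ₗ.[ℂ] E
  isRegular : IsRegular A op

/-! ### Fredholm operators -/

/-- The product `t G`, with domain `{x | G x ∈ D(t)}`. -/
def compBounded (t : E →ₗ.[ℂ] E) (G : E →L[ℂ] E) : E →ₗ.[ℂ] E where
  domain := t.domain.comap G.toLinearMap
  toFun := t.toFun ∘ₗ G.toLinearMap.restrict (fun _ hx => hx)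

/-- `s` is closable, its closure belongs to `L(E)`, and the closure is `1` modulo `K(E)`. -/
def ClosureIsOneModCompact (s : E →ₗ.[ℂ] E) : Prop :=
  s.IsClosable ∧ ∃ T : E →L[ℂ] E, IsAdjointable A T ∧ s.closure = T.toLinearMap.toPMap ⊤ ∧
    T - 1 ∈ compactOperators A E

/-- `G` is a pseudo left inverse of `t`. -/
def IsPseudoLeftInverse (G : E →L[ℂ] E) (t : E →ₗ.[ℂ] E) : Prop :=
  IsAdjointable A G ∧ ClosureIsOneModCompact A (G.toLinearMap.compPMap t)

/-- `G` is a pseudo right inverse of `t`. -/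
def IsPseudoRightInverse (G : E →L[ℂ] E) (t : E →ₗ.[ℂ] E) : Prop :=
  IsAdjointable A G ∧ ClosureIsOneModCompact A (compBounded t G)

variable {A} in
/-- A regular operator is Fredholm if it has a pseudo left inverse and a pseudo right inverse. -/
def RegularOp.IsFredholm (t : RegularOp A E) : Prop :=
  (∃ G : E →L[ℂ] E, IsPseudoLeftInverse A G t.op) ∧
    ∃ G : E →L[ℂ] E, IsPseudoRightInverse A G t.op

variable {A} in
/-- A regular operator is a bounded adjointable operator if it is an everywhere defined operator
that belongs to `L(E)`. -/
def RegularOp.IsBoundedAdjointable (t : RegularOp A E) : Prop :=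
  ∃ T : E →L[ℂ] E, IsAdjointable A T ∧ t.op = T.toLinearMap.toPMap ⊤

/-! ### The orthogonal projection onto the graph and the gap metric -/

variable (E) in
/-- The Hilbert module `E ⊕ E`, with `⟨(x, y), (x', y')⟩ = ⟨x, x'⟩ + ⟨y, y'⟩`. -/
def Sum2 : Type _ := C⋆ᵐᵒᵈ(A, E × E)

instance : NormedAddCommGroup (Sum2 A E) := inferInstanceAs (NormedAddCommGroup C⋆ᵐᵒᵈ(A, E × E))
instance : NormedSpace ℂ (Sum2 A E) := inferInstanceAs (NormedSpace ℂ C⋆ᵐᵒᵈ(A, E × E))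
instance : SMul A (Sum2 A E) := inferInstanceAs (SMul A C⋆ᵐᵒᵈ(A, E × E))
instance : CStarModule A (Sum2 A E) := inferInstanceAs (CStarModule A C⋆ᵐᵒᵈ(A, E × E))
instance [CompleteSpace E] : CompleteSpace (Sum2 A E) :=
  inferInstanceAs (CompleteSpace C⋆ᵐᵒᵈ(A, E × E))

variable (E) in
/-- The identification of `E ⊕ E` with the space of pairs, as topological vector spaces. -/
def toProd : Sum2 A E ≃L[ℂ] E × E := WithCStarModule.equivL (A := A) ℂ

lemma inner_sum2 (v w : Sum2 A E) : ⟪v, w⟫_A =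
    ⟪(toProd A E v).1, (toProd A E w).1⟫_A + ⟪(toProd A E v).2, (toProd A E w).2⟫_A := rfl

/-- The graph of `t` as a submodule of the Hilbert module `E ⊕ E`. -/
def graph (t : E →ₗ.[ℂ] E) : Submodule ℂ (Sum2 A E) :=
  t.graph.comap (toProd A E).toLinearEquiv.toLinearMap

/-- `P` is the orthogonal projection onto `G`. -/
def IsOrthogonalProjection {H : Type*} [NormedAddCommGroup H] [NormedSpace ℂ H] [SMul A H]
    [CStarModule A H] (P : H →L[ℂ] H) (G : Submodule ℂ H) : Prop :=
  ∀ v : H, P v ∈ G ∧ ∀ w ∈ G, ⟪w, v - P v⟫_A = 0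

section complement

variable {H : Type*} [NormedAddCommGroup H] [NormedSpace ℂ H] [SMul A H] [CStarModule A H]

/-- The orthogonal complement of `G`. -/
def orthogonal (G : Submodule ℂ H) : Submodule ℂ H where
  carrier := {v | ∀ w ∈ G, ⟪w, v⟫_A = 0}
  add_mem' := fun hv hv' w hw => by simp [hv w hw, hv' w hw]
  zero_mem' := fun w _ => by simp
  smul_mem' := fun c v hv w hw => by simp [hv w hw]

variable {A} in
lemma norm_le_of_inner_eq_zero {g w : H} (h : ⟪g, w⟫_A = 0) : ‖g‖ ≤ ‖g + w‖ := by
  have h' : ⟪w, g⟫_A = 0 := by rw [← CStarModule.star_inner, h, star_zero]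
  have h2 : ‖g‖ ^ 2 ≤ ‖g + w‖ ^ 2 := by
    rw [CStarModule.norm_sq_eq A, CStarModule.norm_sq_eq A]
    refine CStarAlgebra.norm_le_norm_of_nonneg_of_le CStarModule.inner_self_nonneg ?_
    have : ⟪g + w, g + w⟫_A = ⟪g, g⟫_A + ⟪w, w⟫_A := by simp [h, h']
    rw [this]
    exact le_add_of_nonneg_right CStarModule.inner_self_nonneg
  exact (pow_le_pow_iff_left₀ (norm_nonneg _) (norm_nonneg _) (by simp)).mp h2

lemma exists_orthogonalProjection [CompleteSpace H] (G : Submodule ℂ H)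
    (hG : IsClosed (G : Set H)) (hd : Dense ((G ⊔ orthogonal A G : Submodule ℂ H) : Set H)) :
    ∃ P : H →L[ℂ] H, IsOrthogonalProjection A P G := by
  have hW : IsClosed (orthogonal A G : Set H) := by
    have : (orthogonal A G : Set H) =
        ⋂ w ∈ G, {v : H | CStarModule.innerSL (A := A) w v = 0} := by
      ext v; simp [orthogonal, CStarModule.innerSL_apply]
    rw [this]
    exact isClosed_biInter fun w _ => isClosed_eq (by fun_prop) continuous_const
  have : CompleteSpace G := hG.completeSpace_coe
  have : CompleteSpace (orthogonal A G) := hW.completeSpace_coe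
  let f : (G × orthogonal A G) →L[ℂ] H := G.subtypeL.coprod (orthogonal A G).subtypeL
  have hf : AntilipschitzWith 1 f := by
    refine AddMonoidHomClass.antilipschitz_of_bound f fun p => ?_
    have h1 : ⟪(p.1 : H), (p.2 : H)⟫_A = 0 := p.2.2 _ p.1.2
    have h2 : ⟪(p.2 : H), (p.1 : H)⟫_A = 0 := by rw [← CStarModule.star_inner, h1, star_zero]
    have h3 := norm_le_of_inner_eq_zero h1
    have h4 := norm_le_of_inner_eq_zero h2
    rw [add_comm] at h4
    simpa [f, Prod.norm_def] using And.intro h3 h4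
  have hr : IsClosed (Set.range f) := hf.isClosed_range f.uniformContinuous
  have hrange : Set.range f = ((G ⊔ orthogonal A G : Submodule ℂ H) : Set H) := by
    ext v
    simp only [Set.mem_range, SetLike.mem_coe, Submodule.mem_sup, f]
    constructor
    · rintro ⟨p, rfl⟩
      exact ⟨p.1, p.1.2, p.2, p.2.2, by simp⟩
    · rintro ⟨g, hg, w, hw, rfl⟩
      exact ⟨(⟨g, hg⟩, ⟨w, hw⟩), by simp⟩
  have hs : ∀ v, ∃ p, f p = v := by
    intro v
    have : v ∈ closure (Set.range f) := by rw [hrange]; exact hd v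
    rwa [hr.closure_eq] at this
  let e := ContinuousLinearEquiv.ofBijective f (LinearMap.ker_eq_bot.mpr hf.injective)
    (LinearMap.range_eq_top.mpr hs)
  refine ⟨G.subtypeL.comp ((ContinuousLinearMap.fst ℂ _ _).comp e.symm.toContinuousLinearMap),
    fun v => ⟨by simp, fun w hw => ?_⟩⟩
  have hv : v = ((e.symm v).1 : H) + ((e.symm v).2 : H) := by
    have h1 : f (e.symm v) = v := e.apply_symm_apply v
    exact h1.symm
  have : v - ((e.symm v).1 : H) = ((e.symm v).2 : H) := by
    rw [sub_eq_iff_eq_add']; exact hv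
  have h0 := (e.symm v).2.2 w hw
  simpa [this] using h0

variable {A} in
lemma IsOrthogonalProjection.mem_iff {P : H →L[ℂ] H} {G : Submodule ℂ H}
    (hP : IsOrthogonalProjection A P G) (v : H) : v ∈ G ↔ P v = v := by
  refine ⟨fun hv => ?_, fun hv => hv ▸ (hP v).1⟩
  have := (hP v).2 _ (G.sub_mem hv (hP v).1)
  exact (sub_eq_zero.mp (CStarModule.inner_self.mp this)).symm

end complement

variable {A}

lemma IsRegular.adjoint_graph_eq {t : E →ₗ.[ℂ] E} (ht : IsRegular A t) :
    (adjoint A t).graph = adjointGraph A t := by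
  refine Submodule.toLinearPMap_graph_eq _ ?_
  rintro ⟨y, z⟩ hp (rfl : y = 0)
  have hz : ∀ x ∈ t.domain, ⟪z, x⟫_A = 0 := fun x hx => by
    have h1 := hp ⟨x, hx⟩
    rw [← CStarModule.star_inner, ← h1]; simp
  have : ∀ x : E, ⟪z, x⟫_A = 0 := by
    intro x
    have hc : IsClosed {x : E | CStarModule.innerSL (A := A) z x = 0} :=
      isClosed_eq (by fun_prop) continuous_const
    exact hc.closure_subset_iff.mpr hz (ht.dense_domain x)
  exact CStarModule.inner_self.mp (this z)

lemma IsRegular.inner_adjoint {t : E →ₗ.[ℂ] E} (ht : IsRegular A t) (x : t.domain)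
    (y : (adjoint A t).domain) : ⟪t x, (y : E)⟫_A = ⟪(x : E), adjoint A t y⟫_A := by
  have : ((y : E), adjoint A t y) ∈ adjointGraph A t := by
    rw [← ht.adjoint_graph_eq]; exact LinearPMap.mem_graph _ y
  exact this x

lemma mem_graph_iff {t : E →ₗ.[ℂ] E} {v : Sum2 A E} :
    v ∈ graph A t ↔ toProd A E v ∈ t.graph := Iff.rfl

lemma IsRegular.isClosed_graph {t : E →ₗ.[ℂ] E} (ht : IsRegular A t) :
    IsClosed (graph A t : Set (Sum2 A E)) :=
  IsClosed.preimage (toProd A E).continuous ht.isClosed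

lemma IsRegular.dense_sup {t : E →ₗ.[ℂ] E} (ht : IsRegular A t) :
    Dense ((graph A t ⊔ orthogonal A (graph A t) : Submodule ℂ (Sum2 A E)) :
      Set (Sum2 A E)) := by
  set K := graph A t ⊔ orthogonal A (graph A t)
  have hG : ∀ x : t.domain, (toProd A E).symm ((x : E), t x) ∈ K := fun x =>
    Submodule.mem_sup_left (by simp [mem_graph_iff])
  have hW : ∀ y : (adjoint A t).domain, (toProd A E).symm (-adjoint A t y, (y : E)) ∈ K := by
    refine fun y => Submodule.mem_sup_right fun w hw => ?_
    obtain ⟨x, hx1, hx2⟩ := (LinearPMap.mem_graph_iff _).mp (mem_graph_iff.mp hw)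
    rw [inner_sum2, ← hx1, ← hx2]
    simp [ht.inner_adjoint x y]
  -- it suffices that the closure of `K` contains both summands
  set C := (K.topologicalClosure).comap (toProd A E).symm.toLinearEquiv.toLinearMap
  have hKC : ∀ p : E × E, (toProd A E).symm p ∈ K → p ∈ C := fun p hp =>
    K.le_topologicalClosure hp
  have hC : IsClosed (C : Set (E × E)) :=
    K.isClosed_topologicalClosure.preimage (toProd A E).symm.continuous
  have hfst : ∀ z : E, (z, (0 : E)) ∈ C := by
    have hc : IsClosed {z : E | (z, (0 : E)) ∈ C} := hC.preimage (by fun_prop)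
    intro z
    refine hc.closure_subset_iff.mpr ?_ (ht.dense_range z)
    rintro _ ⟨x, h, rfl⟩
    have := C.sub_mem (hKC _ (hG x)) (hKC _ (hW ⟨t x, h⟩))
    simpa using this
  have hsnd : ∀ y : E, ((0 : E), y) ∈ C := by
    have hc : IsClosed {y : E | ((0 : E), y) ∈ C} := hC.preimage (by fun_prop)
    intro y
    refine hc.closure_subset_iff.mpr ?_ (ht.dense_adjoint_domain y)
    intro y hy
    have := C.add_mem (hKC _ (hW ⟨y, hy⟩)) (hfst (adjoint A t ⟨y, hy⟩))
    simpa using this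
  intro v
  have h : toProd A E v ∈ C := by
    have := C.add_mem (hfst (toProd A E v).1) (hsnd (toProd A E v).2)
    simpa using this
  have h' : (toProd A E).symm (toProd A E v) ∈ K.topologicalClosure := h
  rwa [ContinuousLinearEquiv.symm_apply_apply] at h'

/-- The graph of a regular operator is orthogonally complemented in `E ⊕ E`. -/
theorem IsRegular.exists_projection [CompleteSpace E] {t : E →ₗ.[ℂ] E} (ht : IsRegular A t) :
    ∃ P : Sum2 A E →L[ℂ] Sum2 A E, IsOrthogonalProjection A P (graph A t) :=
  exists_orthogonalProjection A _ ht.isClosed_graph ht.dense_sup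

namespace RegularOp

variable [CompleteSpace E]

/-- The orthogonal projection of `E ⊕ E` onto the graph of `t`. -/
def graphProj (t : RegularOp A E) : Sum2 A E →L[ℂ] Sum2 A E :=
  t.isRegular.exists_projection.choose

lemma graphProj_spec (t : RegularOp A E) :
    IsOrthogonalProjection A t.graphProj (graph A t.op) :=
  t.isRegular.exists_projection.choose_spec

lemma graphProj_injective :
    Function.Injective (graphProj : RegularOp A E → _) := by
  rintro ⟨t, ht⟩ ⟨s, hs⟩ h
  have hts : t = s := by
    refine LinearPMap.eq_of_eq_graph (SetLike.ext fun v => ?_)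
    have h1 := (graphProj_spec ⟨t, ht⟩).mem_iff ((toProd A E).symm v)
    have h2 := (graphProj_spec ⟨s, hs⟩).mem_iff ((toProd A E).symm v)
    rw [h] at h1
    rw [mem_graph_iff, ContinuousLinearEquiv.apply_symm_apply] at h1 h2
    exact h1.trans h2.symm
  subst hts; rfl

/-- The gap metric on `R(E)`: `g(t, s) = ‖P_{G(t)} - P_{G(s)}‖` (operator norm on `E ⊕ E`). -/
instance : MetricSpace (RegularOp A E) where
  dist t s := ‖t.graphProj - s.graphProj‖
  dist_self t := by simp
  dist_comm t s := norm_sub_rev _ _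
  dist_triangle t s u := norm_sub_le_norm_sub_add_norm_sub _ _ _
  eq_of_dist_eq_zero h := graphProj_injective (sub_eq_zero.mp (norm_eq_zero.mp h))

end RegularOp

end HilbertCStar

end

open Filter Topology

namespace HilbertCStar

variable {A E : Type*} [NonUnitalCStarAlgebra A] [PartialOrder A] [StarOrderedRing A]
  [NormedAddCommGroup E] [NormedSpace ℂ E] [SMul A E] [CStarModule A E]

/-! ### The algebra of bounded adjointable operators -/

/-! Near a bounded operator `T`, gap convergence forces norm convergence, and in norm the Fredholm
condition is open by a Neumann series. If `Q` projects onto the graph of `s`, then `x ↦ π₁ (Q (x, T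
x))` depends continuously on `s` and is the identity when `s = T`. For nearby `s` it is therefore
invertible, so every vector is the first coordinate of a point of the graph: `s` is everywhere
defined, and it is `graphSnd` times the inverse of `graphFst`, which tends to `T` in norm
(`exists_tendsto_of_eq_toPMap_top`). Regularity of `s` then makes it adjointable
(`IsRegular.isAdjointable`). An inverse of `T` modulo the ideal of compacts is corrected by an
invertible factor close to `1` into an inverse of `s` modulo compacts
(`eventually_exists_leftInverse_modCompact` and its right-hand twin). -/

lemma inner_map_right_of_adjoint {T S : E →L[ℂ] E} (h : ∀ x y : E, ⟪T x, y⟫_A = ⟪x, S y⟫_A)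
    (x y : E) : ⟪x, T y⟫_A = ⟪S x, y⟫_A := by
  rw [← CStarModule.star_inner, h, CStarModule.star_inner]

lemma norm_le_of_norm_inner_self_le {z : E} {c : ℝ} (hc : 0 ≤ c)
    (h : ‖⟪z, z⟫_A‖ ≤ c * ‖z‖) : ‖z‖ ≤ c := by
  rw [← CStarModule.norm_sq_eq A] at h
  rcases (norm_nonneg z).eq_or_lt with h0 | h0
  · rwa [← h0]
  · exact le_of_mul_le_mul_right (by rwa [pow_two] at h) h0

/-- Test the relation at `x = z`. It concerns a single pair `(y, z)`, so it also bounds an adjoint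
that is only known to be densely defined. -/
lemma norm_adjoint_apply_le {T : E →L[ℂ] E} {y z : E}
    (h : ∀ x : E, ⟪T x, y⟫_A = ⟪x, z⟫_A) : ‖z‖ ≤ ‖T‖ * ‖y‖ := by
  refine norm_le_of_norm_inner_self_le (A := A) (by positivity) ?_
  rw [← h z]
  calc ‖⟪T z, y⟫_A‖ ≤ ‖T z‖ * ‖y‖ := CStarModule.norm_inner_le E
    _ ≤ ‖T‖ * ‖z‖ * ‖y‖ := mul_le_mul_of_nonneg_right (T.le_opNorm z) (norm_nonneg _)
    _ = ‖T‖ * ‖y‖ * ‖z‖ := by ring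

lemma norm_adjoint_le {T S : E →L[ℂ] E} (h : ∀ x y : E, ⟪T x, y⟫_A = ⟪x, S y⟫_A) :
    ‖S‖ ≤ ‖T‖ :=
  S.opNorm_le_bound (norm_nonneg _) fun y => norm_adjoint_apply_le fun x => h x y

namespace IsAdjointable

variable {T S : E →L[ℂ] E}

lemma sub (hT : IsAdjointable A T) (hS : IsAdjointable A S) : IsAdjointable A (T - S) := by
  obtain ⟨T', hT⟩ := hT
  obtain ⟨S', hS⟩ := hS
  exact ⟨T' - S', fun x y => by simp [hT, hS]⟩

lemma mul (hT : IsAdjointable A T) (hS : IsAdjointable A S) : IsAdjointable A (T * S) := by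
  obtain ⟨T', hT⟩ := hT
  obtain ⟨S', hS⟩ := hS
  exact ⟨S' * T', fun x y => by simp [hT, hS]⟩

lemma map_smul (hT : IsAdjointable A T) (a : A) (x : E) : T (a • x) = a • T x := by
  obtain ⟨S, h⟩ := hT
  refine eq_of_inner_eq (A := A) fun z => ?_
  simp [inner_map_right_of_adjoint h]

/-- The inverse of a small adjointable perturbation of the identity is adjointable. -/
lemma oneSub_inv [CompleteSpace E] (hT : IsAdjointable A T) (h1 : ‖T‖ < 1) :
    IsAdjointable A (↑(Units.oneSub T h1)⁻¹ : E →L[ℂ] E) := by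
  obtain ⟨S, h⟩ := hT
  have h1' : ‖S‖ < 1 := (norm_adjoint_le h).trans_lt h1
  refine ⟨↑(Units.oneSub S h1')⁻¹, fun x y => ?_⟩
  have hx : (1 - T) ((↑(Units.oneSub T h1)⁻¹ : E →L[ℂ] E) x) = x :=
    DFunLike.congr_fun (Units.oneSub T h1).mul_inv x
  have hy : (1 - S) ((↑(Units.oneSub S h1')⁻¹ : E →L[ℂ] E) y) = y :=
    DFunLike.congr_fun (Units.oneSub S h1').mul_inv y
  generalize (↑(Units.oneSub T h1)⁻¹ : E →L[ℂ] E) x = u at hx ⊢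
  generalize (↑(Units.oneSub S h1')⁻¹ : E →L[ℂ] E) y = v at hy ⊢
  -- With `x = (1 - T) u` and `y = (1 - S) v`, the claim says that `1 - T` and `1 - S` are adjoint.
  rw [← hx, ← hy]
  simp [h]

lemma mul_elementary (hT : IsAdjointable A T) (x y : E) :
    T * elementary A x y = elementary A (T x) y := by
  ext z
  exact hT.map_smul _ _

lemma elementary_mul {T' : E →L[ℂ] E} (h : ∀ x y : E, ⟪T x, y⟫_A = ⟪x, T' y⟫_A) (x y : E) :
    elementary A x y * T = elementary A x (T' y) := by
  ext z
  change ⟪y, T z⟫_A • x = ⟪T' y, z⟫_A • x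
  rw [inner_map_right_of_adjoint h]

end IsAdjointable

/-! ### The compact operators form an ideal -/

/-- The preimage of a closed subspace under `f` is a closed subspace, so generators suffice. Left
and right multiplications are the instances needed. -/
lemma map_mem_compactOperators (f : (E →L[ℂ] E) →L[ℂ] (E →L[ℂ] E))
    (hf : ∀ x y : E, ∃ x' y' : E, f (elementary A x y) = elementary A x' y')
    {K : E →L[ℂ] E} (hK : K ∈ compactOperators A E) : f K ∈ compactOperators A E := by
  have hle : Submodule.span ℂ {T : E →L[ℂ] E | ∃ x y : E, T = elementary A x y} ≤
      (compactOperators A E).comap f.toLinearMap := by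
    refine Submodule.span_le.mpr ?_
    rintro _ ⟨x, y, rfl⟩
    exact Submodule.le_topologicalClosure _ (Submodule.subset_span (hf x y))
  exact Submodule.topologicalClosure_minimal _ hle
    ((Submodule.isClosed_topologicalClosure _).preimage f.continuous) hK

lemma IsAdjointable.mul_mem_compactOperators {T K : E →L[ℂ] E} (hT : IsAdjointable A T)
    (hK : K ∈ compactOperators A E) : T * K ∈ compactOperators A E :=
  map_mem_compactOperators (ContinuousLinearMap.mul ℂ (E →L[ℂ] E) T)
    (fun x y => ⟨T x, y, hT.mul_elementary x y⟩) hK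

lemma IsAdjointable.compactOperators_mul_mem {T K : E →L[ℂ] E} (hT : IsAdjointable A T)
    (hK : K ∈ compactOperators A E) : K * T ∈ compactOperators A E := by
  obtain ⟨T', h⟩ := hT
  exact map_mem_compactOperators ((ContinuousLinearMap.mul ℂ (E →L[ℂ] E)).flip T)
    (fun x y => ⟨x, T' y, elementary_mul h x y⟩) hK

/-! ### Everywhere defined operators -/

lemma isClosed_toPMap_top (T : E →L[ℂ] E) : (T.toLinearMap.toPMap ⊤).IsClosed := by
  have : ((T.toLinearMap.toPMap ⊤).graph : Set (E × E)) = {p | T p.1 = p.2} := by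
    ext p
    simp [LinearPMap.mem_graph_iff]
  rw [LinearPMap.IsClosed, this]
  exact isClosed_eq (by fun_prop) continuous_snd

lemma closure_toPMap_top (T : E →L[ℂ] E) :
    (T.toLinearMap.toPMap ⊤).closure = T.toLinearMap.toPMap ⊤ := by
  refine LinearPMap.eq_of_eq_graph ?_
  rw [← (isClosed_toPMap_top T).isClosable.graph_closure_eq_closure_graph]
  exact IsClosed.submodule_topologicalClosure_eq (isClosed_toPMap_top T)

lemma toPMap_top_injective {T S : E →L[ℂ] E}
    (h : T.toLinearMap.toPMap ⊤ = S.toLinearMap.toPMap ⊤) : T = S := by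
  ext x
  have hx : (x, T x) ∈ (S.toLinearMap.toPMap ⊤).graph := by
    rw [← h]
    simp [LinearPMap.mem_graph_iff]
  simpa [LinearPMap.mem_graph_iff, eq_comm] using hx

/-- A bounded everywhere defined operator is its own closure, so the unbounded Fredholm conditions
become congruences modulo compacts. -/
lemma closureIsOneModCompact_toPMap_top {T : E →L[ℂ] E} :
    ClosureIsOneModCompact A (T.toLinearMap.toPMap ⊤) ↔
      IsAdjointable A T ∧ T - 1 ∈ compactOperators A E := by
  constructor
  · rintro ⟨-, S, hS, h, hK⟩
    rw [closure_toPMap_top] at h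
    obtain rfl := toPMap_top_injective h
    exact ⟨hS, hK⟩
  · rintro ⟨hT, hK⟩
    exact ⟨(isClosed_toPMap_top T).isClosable, T, hT, closure_toPMap_top T, hK⟩

lemma isPseudoLeftInverse_toPMap_top {G T : E →L[ℂ] E} (hT : IsAdjointable A T) :
    IsPseudoLeftInverse A G (T.toLinearMap.toPMap ⊤) ↔
      IsAdjointable A G ∧ G * T - 1 ∈ compactOperators A E := by
  have h : G.toLinearMap.compPMap (T.toLinearMap.toPMap ⊤) = (G * T).toLinearMap.toPMap ⊤ := rfl
  rw [IsPseudoLeftInverse, h, closureIsOneModCompact_toPMap_top]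
  exact ⟨fun ⟨hG, _, hK⟩ => ⟨hG, hK⟩, fun ⟨hG, hK⟩ => ⟨hG, hG.mul hT, hK⟩⟩

lemma isPseudoRightInverse_toPMap_top {G T : E →L[ℂ] E} (hT : IsAdjointable A T) :
    IsPseudoRightInverse A G (T.toLinearMap.toPMap ⊤) ↔
      IsAdjointable A G ∧ T * G - 1 ∈ compactOperators A E := by
  have h : compBounded (T.toLinearMap.toPMap ⊤) G = (T * G).toLinearMap.toPMap ⊤ := rfl
  rw [IsPseudoRightInverse, h, closureIsOneModCompact_toPMap_top]
  exact ⟨fun ⟨hG, _, hK⟩ => ⟨hG, hK⟩, fun ⟨hG, hK⟩ => ⟨hG, hT.mul hG, hK⟩⟩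

/-- An everywhere defined bounded regular operator is adjointable. -/
lemma IsRegular.isAdjointable [CompleteSpace E] {T : E →L[ℂ] E}
    (h : IsRegular A (T.toLinearMap.toPMap ⊤)) : IsAdjointable A T := by
  set s := T.toLinearMap.toPMap ⊤
  have hin : ∀ (x : E) (y : (adjoint A s).domain), ⟪T x, (y : E)⟫_A = ⟪x, adjoint A s y⟫_A :=
    fun x y => h.inner_adjoint ⟨x, trivial⟩ y
  have hd : DenseRange (adjoint A s).domain.subtype := by
    simpa [DenseRange] using h.dense_adjoint_domain
  -- The adjoint is bounded by `‖T‖` on its dense domain; its continuous extension inherits the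
  -- adjoint relation by density.
  refine ⟨(adjoint A s).toFun.extendOfNorm (adjoint A s).domain.subtype, fun x y => ?_⟩
  refine hd.induction (P := fun y => ⟪T x, y⟫_A = ⟪x, _⟫_A) ?_ ?_ y
  · rintro _ ⟨y, rfl⟩
    rw [LinearMap.extendOfNorm_eq hd ⟨‖T‖, fun y => norm_adjoint_apply_le fun x => hin x y⟩]
    exact hin x y
  · exact isClosed_eq (CStarModule.innerSL (A := A) (T x)).continuous
      ((CStarModule.innerSL (A := A) x).continuous.comp (ContinuousLinearMap.continuous _))

/-! ### Stability of pseudo inverses -/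

/-- With `u = 1 - G (T - S)`, one has `G S - u = G T - 1`, a compact operator; hence `u⁻¹ G` works
once `u` is invertible. Adjointability of `S` is a separate hypothesis because the neighbourhood is
taken among all bounded operators. -/
lemma eventually_exists_leftInverse_modCompact [CompleteSpace E] {G T : E →L[ℂ] E}
    (hG : IsAdjointable A G) (hT : IsAdjointable A T) (hK : G * T - 1 ∈ compactOperators A E) :
    ∀ᶠ S in 𝓝 T, IsAdjointable A S →
      ∃ G', IsAdjointable A G' ∧ G' * S - 1 ∈ compactOperators A E := by
  have hc : Continuous fun S : E →L[ℂ] E => ‖G * (T - S)‖ := by fun_prop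
  filter_upwards [hc.continuousAt.eventually_lt (x₀ := T) (continuousAt_const (y := (1 : ℝ)))
    (by simp)]
    with S (h1 : ‖G * (T - S)‖ < 1) hS
  have hu := (hG.mul (hT.sub hS)).oneSub_inv h1
  set u := Units.oneSub (G * (T - S)) h1
  refine ⟨↑u⁻¹ * G, hu.mul hG, ?_⟩
  have : ↑u⁻¹ * G * S - 1 = ↑u⁻¹ * (G * T - 1) := by
    rw [show G * T - 1 = G * S - ↑u by simp only [u, Units.val_oneSub]; noncomm_ring,
      mul_sub, Units.inv_mul, mul_assoc]
  rw [this]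
  exact hu.mul_mem_compactOperators hK

/-- The mirror argument, with `u = 1 - (T - S) G` and right inverse `G u⁻¹`. -/
lemma eventually_exists_rightInverse_modCompact [CompleteSpace E] {G T : E →L[ℂ] E}
    (hG : IsAdjointable A G) (hT : IsAdjointable A T) (hK : T * G - 1 ∈ compactOperators A E) :
    ∀ᶠ S in 𝓝 T, IsAdjointable A S →
      ∃ G', IsAdjointable A G' ∧ S * G' - 1 ∈ compactOperators A E := by
  have hc : Continuous fun S : E →L[ℂ] E => ‖(T - S) * G‖ := by fun_prop
  filter_upwards [hc.continuousAt.eventually_lt (x₀ := T) (continuousAt_const (y := (1 : ℝ)))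
    (by simp)]
    with S (h1 : ‖(T - S) * G‖ < 1) hS
  have hu := ((hT.sub hS).mul hG).oneSub_inv h1
  set u := Units.oneSub ((T - S) * G) h1
  refine ⟨G * ↑u⁻¹, hG.mul hu, ?_⟩
  have : S * (G * ↑u⁻¹) - 1 = (T * G - 1) * ↑u⁻¹ := by
    rw [show T * G - 1 = S * G - ↑u by simp only [u, Units.val_oneSub]; noncomm_ring,
      sub_mul, Units.mul_inv, mul_assoc]
  rw [this]
  exact hu.compactOperators_mul_mem hK

/-! ### Operators near a bounded operator in the gap metric -/

section gap

variable [CompleteSpace E]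

/-- The map `x ↦ π₁ (Q (x, T x))`. -/
noncomputable def graphFst (T : E →L[ℂ] E) (Q : Sum2 A E →L[ℂ] Sum2 A E) : E →L[ℂ] E :=
  (ContinuousLinearMap.fst ℂ E E ∘L (toProd A E : Sum2 A E →L[ℂ] E × E)) ∘L
    (Q ∘L ((toProd A E).symm : E × E →L[ℂ] Sum2 A E) ∘L (ContinuousLinearMap.id ℂ E).prod T)

/-- The map `x ↦ π₂ (Q (x, T x))`. -/
noncomputable def graphSnd (T : E →L[ℂ] E) (Q : Sum2 A E →L[ℂ] Sum2 A E) : E →L[ℂ] E :=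
  (ContinuousLinearMap.snd ℂ E E ∘L (toProd A E : Sum2 A E →L[ℂ] E × E)) ∘L
    (Q ∘L ((toProd A E).symm : E × E →L[ℂ] Sum2 A E) ∘L (ContinuousLinearMap.id ℂ E).prod T)

lemma continuous_graphFst (T : E →L[ℂ] E) : Continuous (graphFst (A := A) T) := by
  unfold graphFst
  fun_prop

lemma continuous_graphSnd (T : E →L[ℂ] E) : Continuous (graphSnd (A := A) T) := by
  unfold graphSnd
  fun_prop

/-- If `π₁ (Q (x, T x))` is invertible as a function of `x`, where `Q` is the projection onto the
graph of `s`, then `s` is everywhere defined and bounded. -/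
lemma eq_toPMap_top_of_isUnit {s : E →ₗ.[ℂ] E} {T : E →L[ℂ] E} {Q : Sum2 A E →L[ℂ] Sum2 A E}
    (hQ : IsOrthogonalProjection A Q (graph A s)) (hu : IsUnit (graphFst T Q)) :
    s = (graphSnd T Q * Ring.inverse (graphFst T Q)).toLinearMap.toPMap ⊤ := by
  set R := Ring.inverse (graphFst T Q)
  -- Apply `Q` to `(R x, T (R x))`: the result lies in the graph of `s` and has first coordinate
  -- `x`.
  have hs : ∀ x : E, (x, (graphSnd T Q * R) x) ∈ s.graph := fun x => by
    have h1 : graphFst T Q (R x) = x := DFunLike.congr_fun (Ring.mul_inverse_cancel _ hu) x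
    have h2 : (graphFst T Q (R x), graphSnd T Q (R x)) ∈ s.graph := (hQ _).1
    rwa [h1] at h2
  refine (LinearPMap.eq_of_le_of_domain_eq (LinearPMap.le_of_le_graph ?_) ?_).symm
  · intro p hp
    obtain ⟨x, h1, h2⟩ := (LinearPMap.mem_graph_iff _).mp hp
    have := hs x
    rwa [show ((x : E), (graphSnd T Q * R) x) = p from Prod.ext h1 h2] at this
  · exact (eq_top_iff.mpr fun x _ => LinearPMap.mem_domain_of_mem_graph (hs x)).symm

namespace RegularOp

/-- The gap metric is pulled back from the operator norm along this map, which is thus an isometry.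
-/
lemma continuous_graphProj :
    Continuous (graphProj : RegularOp A E → Sum2 A E →L[ℂ] Sum2 A E) :=
  (Isometry.of_dist_eq fun t s => (dist_eq_norm t.graphProj s.graphProj)).continuous

/-- In the gap metric, the operators close to a bounded one are bounded, and converge to it
in norm. -/
lemma exists_tendsto_of_eq_toPMap_top {t : RegularOp A E} {T : E →L[ℂ] E}
    (ht : t.op = T.toLinearMap.toPMap ⊤) :
    ∃ F : RegularOp A E → E →L[ℂ] E, Tendsto F (𝓝 t) (𝓝 T) ∧
      ∀ᶠ s in 𝓝 t, s.op = (F s).toLinearMap.toPMap ⊤ := by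
  -- The projection fixes the graph of `t`, so at `s = t` the two coordinate maps are `1` and `T`.
  have hP : ∀ x : E, t.graphProj ((toProd A E).symm (x, T x)) = (toProd A E).symm (x, T x) :=
    fun x => (t.graphProj_spec.mem_iff _).mp (by
      rw [mem_graph_iff, ContinuousLinearEquiv.apply_symm_apply, ht]
      simp [LinearPMap.mem_graph_iff])
  have h1 : graphFst T t.graphProj = 1 := by
    ext x
    change (toProd A E (t.graphProj ((toProd A E).symm (x, T x)))).1 = x
    rw [hP, ContinuousLinearEquiv.apply_symm_apply]
  have h2 : graphSnd T t.graphProj = T := by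
    ext x
    change (toProd A E (t.graphProj ((toProd A E).symm (x, T x)))).2 = T x
    rw [hP, ContinuousLinearEquiv.apply_symm_apply]
  have hfst : ContinuousAt (fun s : RegularOp A E => graphFst T s.graphProj) t :=
    ((continuous_graphFst T).comp continuous_graphProj).continuousAt
  have hsnd : ContinuousAt (fun s : RegularOp A E => graphSnd T s.graphProj) t :=
    ((continuous_graphSnd T).comp continuous_graphProj).continuousAt
  have hinv : ContinuousAt Ring.inverse (graphFst T t.graphProj) := by
    rw [h1]
    exact NormedRing.inverse_continuousAt 1
  refine ⟨fun s => graphSnd T s.graphProj * Ring.inverse (graphFst T s.graphProj), ?_, ?_⟩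
  · have := Tendsto.mul hsnd (Tendsto.comp hinv hfst)
    beta_reduce at this
    rwa [h1, h2, Ring.inverse_one, mul_one] at this
  · have hU : ∀ᶠ s in 𝓝 t, IsUnit (graphFst T s.graphProj) :=
      hfst.eventually (Units.isOpen.mem_nhds (show IsUnit (graphFst T t.graphProj) from h1 ▸ isUnit_one))
    exact hU.mono fun s hs => eq_toPMap_top_of_isUnit s.graphProj_spec hs

end RegularOp

end gap

end HilbertCStar

open HilbertCStar in
theorem mainTheorem9 {A E : Type*} [NonUnitalCStarAlgebra A] [PartialOrder A] [StarOrderedRing A]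
    [NormedAddCommGroup E] [NormedSpace ℂ E] [SMul A E] [CStarModule A E] [CompleteSpace E] :
    IsOpen {t : HilbertCStar.RegularOp A E | t.IsBoundedAdjointable ∧ t.IsFredholm} := by
  refine isOpen_iff_mem_nhds.mpr ?_
  rintro t ⟨⟨T, hT, htT⟩, ⟨G, hG⟩, G', hG'⟩
  rw [htT] at hG hG'
  obtain ⟨hGa, hGK⟩ := (isPseudoLeftInverse_toPMap_top hT).mp hG
  obtain ⟨hGa', hGK'⟩ := (isPseudoRightInverse_toPMap_top hT).mp hG'
  obtain ⟨F, hF, hop⟩ := RegularOp.exists_tendsto_of_eq_toPMap_top htT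
  filter_upwards [hop, hF.eventually (eventually_exists_leftInverse_modCompact hGa hT hGK),
    hF.eventually (eventually_exists_rightInverse_modCompact hGa' hT hGK')] with s hs hl hr
  -- Norm closeness to `T` alone would not give adjointability; it comes from the regularity of `s`.
  have hFs : IsAdjointable A (F s) := IsRegular.isAdjointable (hs ▸ s.isRegular)
  obtain ⟨L, hL⟩ := hl hFs
  obtain ⟨R, hR⟩ := hr hFs
  refine ⟨⟨F s, hFs, hs⟩, ⟨L, ?_⟩, R, ?_⟩
  · rw [hs]
    exact (isPseudoLeftInverse_toPMap_top hFs).mpr hL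
  · rw [hs]
    exact (isPseudoRightInverse_toPMap_top hFs).mpr hR
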